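/- Let $\mathbb{F}_q$ be a finite field with $q$ elements, and put $\theta_q(r)=\sum_{\nu=0}^{r}q^{\nu}$ for $r\ge 0$. Let $m\ge 1$ and $d\ge 2$ be integers, and let $\mathcal{X}=\{F=0\}$ be a hypersurface of degree $d$ in $\mathbb{P}^m$ defined over $\mathbb{F}_q$, where $F\in\mathbb{F}_q[X_0,\dots,X_m]$ is a nonzero homogeneous polynomial of degree $d$. Suppose that $\mathcal{X}$ is nonsingular over the algebraic closure $\overline{\mathbb{F}}_q$, that is, $F$ and $\partial F/\partial X_0,\dots,\partial F/\partial X_m$ have no common zero in $\mathbb{P}^m(\overline{\mathbb{F}}_q)$. Let $N_q(\mathcal{X})$ be the number of points of $\mathbb{P}^m(\mathbb{F}_q)$ at which $F$ vanishes (counted without multiplicity). (i) If $m$ is odd, then $$N_q(\mathcal{X})\le \theta_q\!\left(\tfrac{m-1}{2}\right)\cdot\left((d-1)q^{\frac{m-1}{2}}+1\right).$$ (ii) If $m$ is even, then $$N_q(\mathcal{X})\le \theta_q\!\left(\tfrac{m}{2}\right)q^{\frac{m}{2}-1}(d-1)+\theta_q\!\left(\tfrac{m}{2}-1\right).$$ 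-/

import Mathlib

open scoped LinearAlgebra.Projectivization

/-- `θ_q(m) = 1 + q + ⋯ + q ^ m`, the number of `𝔽_q`-points of projective `m`-space. -/
def theta (q m : ℕ) : ℕ := ∑ i ∈ Finset.range (m + 1), q ^ i

/-- A hypersurface of degree `d` in projective `m`-space over the field `K`, given by its equation:
a nonzero homogeneous polynomial of degree `d` in `m + 1` variables with coefficients in `K`. -/
structure ProjHypersurface (K : Type*) [Field K] (m d : ℕ) where
  /-- The equation of the hypersurface. -/
  equation : MvPolynomial (Fin (m + 1)) K
  equation_ne_zero : equation ≠ 0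
  isHomogeneous : equation.IsHomogeneous d

namespace ProjHypersurface

variable {K : Type*} [Field K] {m d : ℕ}

/-- The set of `K`-points of the hypersurface, without multiplicities. -/
def points (X : ProjHypersurface K m d) : Set (ℙ K (Fin (m + 1) → K)) :=
  {P | MvPolynomial.eval P.rep X.equation = 0}

/-- The same hypersurface, considered over an extension field `L` of `K`. -/
noncomputable def baseChange (X : ProjHypersurface K m d) (L : Type*) [Field L] [Algebra K L] :
    ProjHypersurface L m d where
  equation := MvPolynomial.map (algebraMap K L) X.equation
  equation_ne_zero := fun h => X.equation_ne_zero
    (MvPolynomial.map_injective _ (algebraMap K L).injective (by rw [h, map_zero]))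
  isHomogeneous := X.isHomogeneous.map _

/-- The `K`-point `P` of projective space is a singular point of the hypersurface: the equation and
all of its first partial derivatives vanish at `P`. -/
def IsSingularAt (X : ProjHypersurface K m d) (P : ℙ K (Fin (m + 1) → K)) : Prop :=
  P ∈ X.points ∧ ∀ i, MvPolynomial.eval P.rep (MvPolynomial.pderiv i X.equation) = 0

/-- The hypersurface is nonsingular: it has no singular point over the algebraic closure. -/
def IsNonsingular (X : ProjHypersurface K m d) : Prop :=
  ∀ P : ℙ (AlgebraicClosure K) (Fin (m + 1) → AlgebraicClosure K),
    ¬ (X.baseChange (AlgebraicClosure K)).IsSingularAt P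

/-- The number of `K`-points of the hypersurface (meaningful for a finite field `K`). -/
noncomputable def numPoints (X : ProjHypersurface K m d) : ℕ := X.points.ncard

/-- Vanishing of a homogeneous polynomial does not depend on the chosen representative. -/
theorem eval_rep_mk_eq_zero_iff {f : MvPolynomial (Fin (m + 1)) K} {e : ℕ}
    (hf : f.IsHomogeneous e) (v : Fin (m + 1) → K) (hv : v ≠ 0) :
    MvPolynomial.eval (Projectivization.mk K v hv).rep f = 0 ↔ MvPolynomial.eval v f = 0 := by
  obtain ⟨a, ha⟩ := Projectivization.exists_smul_eq_mk_rep K v hv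
  have h : MvPolynomial.eval ((a : K) • v) f = (a : K) ^ e * MvPolynomial.eval v f := by
    rw [MvPolynomial.eval_eq, MvPolynomial.eval_eq, Finset.mul_sum]
    refine Finset.sum_congr rfl fun s hs => ?_
    have hdeg : ∑ i ∈ s.support, s i = e := by
      rw [← Finsupp.degree_apply]
      exact hf.degree_eq_sum_deg_support hs |>.symm
    simp only [Pi.smul_apply, smul_eq_mul, mul_pow, Finset.prod_mul_distrib,
      Finset.prod_pow_eq_pow_sum, hdeg]
    ring
  rw [← ha, Units.smul_def, h]
  simp

/-- Membership in the set of points may be tested on any homogeneous coordinate vector. -/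
theorem mk_mem_points_iff (X : ProjHypersurface K m d) (v : Fin (m + 1) → K) (hv : v ≠ 0) :
    Projectivization.mk K v hv ∈ X.points ↔ MvPolynomial.eval v X.equation = 0 :=
  eval_rep_mk_eq_zero_iff X.isHomogeneous v hv

/-- Singularity may be tested on any homogeneous coordinate vector. -/
theorem isSingularAt_mk_iff (X : ProjHypersurface K m d) (v : Fin (m + 1) → K) (hv : v ≠ 0) :
    X.IsSingularAt (Projectivization.mk K v hv) ↔ MvPolynomial.eval v X.equation = 0 ∧
      ∀ i, MvPolynomial.eval v (MvPolynomial.pderiv i X.equation) = 0 :=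
  and_congr (X.mk_mem_points_iff v hv)
    (forall_congr' fun _ => eval_rep_mk_eq_zero_iff X.isHomogeneous.pderiv v hv)

end ProjHypersurface

/-!
Let `F` be the equation, and let `W` be a linear subspace of `K ^ (m + 1)`, of dimension `w`, on
which `F` vanishes identically as a polynomial, and which is maximal with this property.

*Counting.* Let `v ∉ W`. By maximality the form `F (T v + y)`, `y ∈ W`, is not zero, and since `F`
vanishes on `W` it is divisible by `T`. So `F (v + y)` is a nonzero polynomial on `W` of degree at
most `d - 1`, and by the Schwartz–Zippel lemma it has at most `(d - 1) q ^ (w - 1)` zeros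
(`IsHomogeneous.dehomogenize`, `exists_maximal_restrictSpan_eq_zero`). Summing over the cosets of
`W`, the number `Z = 1 + (q - 1) N` of affine zeros of `F` satisfies
`Z ≤ q ^ w + (q ^ (m + 1 - w) - 1) (d - 1) q ^ (w - 1) = (d - 1) q ^ m + (q - d + 1) q ^ (w - 1)`
(`card_zeros_le_of_cosets`). For `d - 1 ≤ q` this increases with `w`; for larger `d` the asserted
bound is at least the number of points of `ℙ^m` (`le_theta_of_card_le`).

*Dimension.* Nonsingularity forces `2 w ≤ m + 1`. Each basis vector of `W` gives, by the chain rule,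
a linear relation between the restrictions to `W` of the `m + 1` partial derivatives of `F`, so
these restrictions span a space of dimension at most `m + 1 - w`. If this were less than `w`, they
would have a common nonzero zero over the algebraic closure, a singular point of the hypersurface
(`exists_singular_of_restrictSpan_eq_zero`). The common zero comes from Krull's height theorem and
the Nullstellensatz: without it the ideal of the origin, of height `w`, would be minimal over an
ideal with fewer than `w` generators (`exists_ne_zero_forall_eval_eq_zero`).
-/

/-! ### Common zeros of few homogeneous forms -/

namespace MvPolynomial

lemma sub_C_constantCoeff_mem_of_X_mem {R σ : Type*} [CommRing R]
    {I : Ideal (MvPolynomial σ R)} (hI : ∀ i, X i ∈ I) (f : MvPolynomial σ R) :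
    f - C (constantCoeff f) ∈ I := by
  induction f using MvPolynomial.induction_on with
  | C a => simp
  | add p q hp hq =>
    have := I.add_mem hp hq
    rw [map_add, C_add]
    convert this using 1
    ring
  | mul_X p i _ => simpa using I.mul_mem_left p (hI i)

/-- The ideal of the coordinate subspace `X₀ = ⋯ = X_{j-1} = 0` has height at least `j`. -/
lemma le_height_ker_aeval {L : Type*} [Field L] {w : ℕ} (j : ℕ) (hj : j ≤ w) :
    (j : ℕ∞) ≤ (RingHom.ker (aeval (R := L)
      (fun i : Fin w => if (i : ℕ) < j then (0 : MvPolynomial (Fin w) L) else X i))).height := by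
  induction j with
  | zero => simp
  | succ j ih =>
    have hlt : RingHom.ker (aeval (R := L)
          (fun i : Fin w => if (i : ℕ) < j then (0 : MvPolynomial (Fin w) L) else X i)) <
        RingHom.ker (aeval (R := L)
          (fun i : Fin w => if (i : ℕ) < j + 1 then (0 : MvPolynomial (Fin w) L) else X i)) := by
      refine lt_of_le_of_ne (fun f hf => ?_) fun h => ?_
      · -- the substitution for `j + 1` factors through the one for `j`
        have key : (aeval (R := L)
            (fun i : Fin w => if (i : ℕ) < j + 1 then (0 : MvPolynomial (Fin w) L) else X i)).comp
            (aeval (R := L)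
              (fun i : Fin w => if (i : ℕ) < j then (0 : MvPolynomial (Fin w) L) else X i)) =
            aeval (R := L)
            (fun i : Fin w => if (i : ℕ) < j + 1 then (0 : MvPolynomial (Fin w) L) else X i) := by
          ext1 i
          by_cases h : (i : ℕ) < j
          · simp [h, Nat.lt_succ_of_lt h, -Order.lt_add_one_iff]
          · simp [h]
        rw [RingHom.mem_ker] at hf ⊢
        rw [← key, AlgHom.comp_apply, hf, map_zero]
      · have : (X ⟨j, hj⟩ : MvPolynomial (Fin w) L) ∈ RingHom.ker (aeval (R := L)
            (fun i : Fin w => if (i : ℕ) < j then (0 : MvPolynomial (Fin w) L) else X i)) := by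
          rw [h]
          simp [RingHom.mem_ker]
        simp [RingHom.mem_ker] at this
    have := fun j : ℕ => RingHom.ker_isPrime (aeval (R := L)
      (fun i : Fin w => if (i : ℕ) < j then (0 : MvPolynomial (Fin w) L) else X i))
    have := Ideal.height_add_one_le_of_lt_of_isPrime hlt
    push_cast
    exact le_trans (by gcongr; exact ih (by omega)) this

/-- Over an algebraically closed field, fewer than `w` polynomials in `w` variables without constant
term have a common zero other than the origin. -/
lemma exists_ne_zero_forall_eval_eq_zero {L : Type*} [Field L] [IsAlgClosed L] {w : ℕ}
    (V : Submodule L (MvPolynomial (Fin w) L)) [FiniteDimensional L V]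
    (hV : Module.finrank L V < w) (h0 : ∀ f ∈ V, constantCoeff f = 0) :
    ∃ y : Fin w → L, y ≠ 0 ∧ ∀ f ∈ V, eval y f = 0 := by
  by_contra! hcon
  let b := Module.finBasis L V
  let s : Set (MvPolynomial (Fin w) L) := Set.range fun k => (b k : MvPolynomial (Fin w) L)
  have hs : s.Finite := Set.finite_range _
  have hcard : s.ncard ≤ Module.finrank L V := by
    rw [show s = _ from Set.image_univ.symm]
    exact (Set.ncard_image_le Set.finite_univ).trans (by simp [Set.ncard_univ])
  let I := Ideal.span s
  have hVI : ∀ f ∈ V, f ∈ I := fun f hf => by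
    have h1 : (⟨f, hf⟩ : V) = ∑ k, b.repr ⟨f, hf⟩ k • b k := (b.sum_repr _).symm
    have h2 : f = ∑ k, b.repr ⟨f, hf⟩ k • (b k : MvPolynomial (Fin w) L) := by
      simpa only [Submodule.coe_sum, Submodule.coe_smul] using congrArg Subtype.val h1
    rw [h2]
    refine I.sum_mem fun k _ => ?_
    rw [smul_eq_C_mul]
    exact I.mul_mem_left _ (Ideal.subset_span ⟨k, rfl⟩)
  -- by the Nullstellensatz, every variable is nilpotent modulo `I`
  have hrad : ∀ i, (X i : MvPolynomial (Fin w) L) ∈ I.radical := fun i => by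
    rw [← vanishingIdeal_zeroLocus_eq_radical (k := L) (K := L), mem_vanishingIdeal_iff]
    intro x hx
    by_cases hx0 : x = 0
    · simp [hx0]
    · obtain ⟨f, hf, hne⟩ := hcon x hx0
      exact absurd (hx f (hVI f hf)) (by simpa [aeval_eq_eval] using hne)
  let p : Ideal (MvPolynomial (Fin w) L) := RingHom.ker (aeval (R := L)
      (fun i : Fin w => if (i : ℕ) < w then (0 : MvPolynomial (Fin w) L) else X i))
  have hp : ∀ f, f ∈ p ↔ constantCoeff f = 0 := fun f => by
    simp only [p, RingHom.mem_ker, Fin.is_lt, if_true]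
    rw [show (fun _ : Fin w => (0 : MvPolynomial (Fin w) L)) = 0 from rfl, aeval_zero,
      algebraMap_eq, C_eq_zero]
  have hIp : I ≤ p := Ideal.span_le.2 <| by
    rintro _ ⟨k, rfl⟩
    exact (hp _).2 (h0 _ (b k).2)
  have hmin : p ∈ I.minimalPrimes := by
    refine ⟨⟨RingHom.ker_isPrime _, hIp⟩, fun r hr _ f hf => ?_⟩
    have hX : ∀ i, (X i : MvPolynomial (Fin w) L) ∈ r := fun i =>
      hr.1.radical_le_iff.2 hr.2 (hrad i)
    simpa [(hp f).1 hf] using sub_C_constantCoeff_mem_of_X_mem hX f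
  have h1 := Ideal.height_le_card_of_mem_minimalPrimes_span hs hmin
  have h2 := (le_height_ker_aeval (L := L) w le_rfl).trans h1
  have h3 : w ≤ s.ncard := by exact_mod_cast h2
  omega

/-! ### Restriction of a polynomial to a subspace -/

/-- The restriction of a polynomial function on `σ → R` to the span of the vectors `e j`, `j : τ`,
as a polynomial in the coordinates with respect to the family `e`. -/
noncomputable def restrictSpan {R σ τ : Type*} [CommRing R] [Fintype τ] (e : τ → σ → R) :
    MvPolynomial σ R →ₐ[R] MvPolynomial τ R :=
  aeval fun i => ∑ j, C (e j i) * X j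

section

variable {R σ τ : Type*} [CommRing R] [Fintype τ]

@[simp] lemma restrictSpan_X (e : τ → σ → R) (i : σ) :
    restrictSpan e (X i) = ∑ j, C (e j i) * X j := by
  simp [restrictSpan]

lemma eval_restrictSpan (e : τ → σ → R) (y : τ → R) (f : MvPolynomial σ R) :
    eval y (restrictSpan e f) = eval (∑ j, y j • e j) f := by
  induction f using MvPolynomial.induction_on with
  | C a => simp [restrictSpan]
  | add p q hp hq => simp [hp, hq]
  | mul_X p i hp => simp [hp, mul_comm]

lemma IsHomogeneous.restrictSpan {f : MvPolynomial σ R} {d : ℕ} (hf : f.IsHomogeneous d)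
    (e : τ → σ → R) : (MvPolynomial.restrictSpan e f).IsHomogeneous d := by
  have := hf.aeval (fun i => ∑ j, C (e j i) * X j) (n := 1) fun i =>
    IsHomogeneous.sum _ _ _ fun j _ => isHomogeneous_C_mul_X _ _
  rwa [one_mul] at this

lemma map_restrictSpan {S : Type*} [CommRing S] (φ : R →+* S) (e : τ → σ → R)
    (f : MvPolynomial σ R) :
    map φ (restrictSpan e f) = restrictSpan (fun j => φ ∘ e j) (map φ f) := by
  induction f using MvPolynomial.induction_on with
  | C a => simp [restrictSpan]
  | add p q hp hq => simp [hp, hq]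
  | mul_X p i hp => simp [hp]

/-- The chain rule for the restriction to a subspace. -/
lemma pderiv_restrictSpan [Fintype σ] (e : τ → σ → R) (j : τ) (f : MvPolynomial σ R) :
    pderiv j (restrictSpan e f) = ∑ i, e j i • restrictSpan e (pderiv i f) := by
  classical
  induction f using MvPolynomial.induction_on with
  | C a => simp [restrictSpan]
  | add p q hp hq => simp [hp, hq, Finset.sum_add_distrib]
  | mul_X p k hp =>
    have h1 : pderiv j (restrictSpan e (X k : MvPolynomial σ R)) = C (e j k) := by
      simp [pderiv_X, Pi.single_apply, Derivation.leibniz]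
    rw [map_mul, Derivation.leibniz, hp, h1]
    simp only [Derivation.leibniz, map_add, smul_add, Finset.sum_add_distrib, smul_eq_mul, map_mul,
      pderiv_X, Pi.single_apply, Finset.mul_sum]
    congr 1
    · rw [Finset.sum_eq_single k]
      · simp [smul_eq_C_mul, mul_comm]
      · intro i _ hi
        simp [hi.symm]
      · simp
    · exact Finset.sum_congr rfl fun i _ => by rw [mul_smul_comm]

end

/-- A form of degree `d ≥ 2` in `n` variables vanishing on a subspace of dimension `w > n / 2` has a
singular zero. Indeed the chain rule gives `w` independent linear relations between the restrictions
of the `n` partial derivatives to the subspace, so that these span a space of dimension at most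
`n - w < w` and have a common zero. -/
lemma exists_singular_of_restrictSpan_eq_zero {L σ : Type*} [Field L] [IsAlgClosed L] [Fintype σ]
    {w d : ℕ} (hd : 2 ≤ d) {f : MvPolynomial σ L} (hf : f.IsHomogeneous d)
    {e : Fin w → σ → L} (he : LinearIndependent L e) (hfe : restrictSpan e f = 0)
    (hw : Fintype.card σ < 2 * w) :
    ∃ x : σ → L, x ≠ 0 ∧ eval x f = 0 ∧ ∀ i, eval x (pderiv i f) = 0 := by
  let T : (σ → L) →ₗ[L] MvPolynomial (Fin w) L :=
    Fintype.linearCombination L fun i => restrictSpan e (pderiv i f)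
  have hT : ∀ c, T c = ∑ i, c i • restrictSpan e (pderiv i f) := fun c =>
    Fintype.linearCombination_apply ..
  have hker : Submodule.span L (Set.range e) ≤ LinearMap.ker T := by
    rw [Submodule.span_le]
    rintro _ ⟨j, rfl⟩
    rw [SetLike.mem_coe, LinearMap.mem_ker, hT, ← pderiv_restrictSpan, hfe, map_zero]
  have hrank : Module.finrank L (LinearMap.range T) < w := by
    have h1 := T.finrank_range_add_finrank_ker
    have h2 := Submodule.finrank_mono hker
    rw [finrank_span_eq_card he, Fintype.card_fin] at h2
    rw [Module.finrank_fintype_fun_eq_card] at h1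
    omega
  obtain ⟨y, hy0, hy⟩ := exists_ne_zero_forall_eval_eq_zero _ hrank <| by
    rintro _ ⟨c, rfl⟩
    rw [hT, map_sum]
    refine Finset.sum_eq_zero fun i _ => ?_
    have h : (restrictSpan e (pderiv i f)).IsHomogeneous (d - 1) := hf.pderiv.restrictSpan e
    have h' : constantCoeff (restrictSpan e (pderiv i f)) = 0 := by
      rw [constantCoeff_eq]
      exact h.coeff_eq_zero (by simp; omega)
    rw [smul_eq_C_mul, map_mul, h', mul_zero]
  refine ⟨∑ j, y j • e j, fun h => hy0 ?_, ?_, fun i => ?_⟩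
  · exact _root_.funext (Fintype.linearIndependent_iff.1 he y h)
  · rw [← eval_restrictSpan, hfe, map_zero]
  · classical
    rw [← eval_restrictSpan]
    exact hy _ ⟨Pi.single i 1, by rw [hT]; simp [Pi.single_apply]⟩

/-! ### Dehomogenization and maximal subspaces -/

/-- Setting the first variable to `1` in a nonzero form of degree `d` divisible by that variable
gives a nonzero polynomial of degree at most `d - 1`. Through `finSuccEquiv` the form is read as a
polynomial in its first variable, and divisibility as the vanishing of the constant term. -/
lemma IsHomogeneous.dehomogenize {R : Type*} [CommRing R] {w d : ℕ}
    {p : MvPolynomial (Fin (w + 1)) R} (hp : p.IsHomogeneous d) (hp0 : p ≠ 0)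
    (h0 : (finSuccEquiv R w p).coeff 0 = 0) :
    (finSuccEquiv R w p).eval 1 ≠ 0 ∧ ((finSuccEquiv R w p).eval 1).totalDegree ≤ d - 1 := by
  have hdeg : ∀ i s, coeff (Finsupp.cons i s) p ≠ 0 → i + s.degree = d := fun i s h => by
    have h1 := hp.degree_eq_sum_deg_support (mem_support_iff.2 h)
    rw [h1, ← Finsupp.degree_apply]
    simp [Finsupp.degree_eq_sum, Fin.sum_univ_succ]
  have hcoeff : ∀ s, coeff s ((finSuccEquiv R w p).eval 1) =
      ∑ i ∈ Finset.range ((finSuccEquiv R w p).natDegree + 1), coeff (Finsupp.cons i s) p :=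
    fun s => by simp [Polynomial.eval_eq_sum_range, coeff_sum, finSuccEquiv_coeff_coeff]
  constructor
  · obtain ⟨t, ht⟩ := ne_zero_iff.1 hp0
    rw [← Finsupp.cons_tail t] at ht
    refine ne_zero_iff.2 ⟨t.tail, ?_⟩
    -- by homogeneity a single term of the sum survives
    rw [hcoeff, Finset.sum_eq_single (t 0)]
    · exact ht
    · intro i _ hi
      by_contra h
      have h1 := hdeg _ _ h
      have h2 := hdeg _ _ ht
      omega
    · intro hi
      rw [← finSuccEquiv_coeff_coeff, Polynomial.coeff_eq_zero_of_natDegree_lt, coeff_zero]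
      simpa using hi
  · refine Finset.sup_le fun s hs => ?_
    rw [mem_support_iff, hcoeff] at hs
    obtain ⟨i, -, hi⟩ := Finset.exists_ne_zero_of_sum_ne_zero hs
    have hi0 : i ≠ 0 := by
      rintro rfl
      exact hi (by rw [← finSuccEquiv_coeff_coeff, h0, coeff_zero])
    have h1 := hdeg i s hi
    rw [Finsupp.degree_apply] at h1
    change s.sum (fun _ e => e) ≤ d - 1
    rw [Finsupp.sum]
    omega

lemma coeff_zero_finSuccEquiv_restrictSpan_cons {R σ : Type*} [CommRing R] {w : ℕ} (v : σ → R)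
    (e : Fin w → σ → R) (g : MvPolynomial σ R) :
    (finSuccEquiv R w (restrictSpan (Fin.cons v e : Fin (w + 1) → σ → R) g)).coeff 0 =
      restrictSpan e g := by
  have hC : ∀ a : R, finSuccEquiv R w (C a) = Polynomial.C (C a) := fun a => by
    simp [finSuccEquiv_apply]
  induction g using MvPolynomial.induction_on with
  | C a => simp [restrictSpan, algebraMap_eq, hC]
  | add a b ha hb => simp only [map_add, Polynomial.coeff_add, ha, hb]
  | mul_X a i ha =>
    have hX : (finSuccEquiv R w (restrictSpan (Fin.cons v e : Fin (w + 1) → σ → R)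
        (X i))).coeff 0 = restrictSpan e (X i) := by
      simp [Fin.sum_univ_succ, Polynomial.finsetSum_coeff, hC, finSuccEquiv_X_succ,
        finSuccEquiv_X_zero]
    rw [map_mul, map_mul, map_mul, Polynomial.mul_coeff_zero, ha, hX]

/-- There is a family of vectors to which no further vector can be added without losing linear
independence or the vanishing of `f` on the span: along every translate of the span by a
vector outside it, `f` restricts to a nonzero polynomial of degree at most `d - 1`. -/
lemma exists_maximal_restrictSpan_eq_zero {K : Type*} [Field K] {n d : ℕ} (hd : d ≠ 0)
    {f : MvPolynomial (Fin n) K} (hf : f.IsHomogeneous d) :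
    ∃ (w : ℕ) (e : Fin w → Fin n → K), LinearIndependent K e ∧ restrictSpan e f = 0 ∧
      ∀ v ∉ Submodule.span K (Set.range e), ∃ h : MvPolynomial (Fin w) K, h ≠ 0 ∧
        h.totalDegree ≤ d - 1 ∧ ∀ y, eval y h = eval (v + ∑ j, y j • e j) f := by
  classical
  let Q : ℕ → Prop := fun w =>
    ∃ e : Fin w → Fin n → K, LinearIndependent K e ∧ restrictSpan e f = 0
  have hQ0 : Q 0 := by
    refine ⟨Fin.elim0, linearIndependent_empty_type, ?_⟩
    rw [eq_C_of_isEmpty (restrictSpan _ f), C_eq_zero]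
    exact (hf.restrictSpan (τ := Fin 0) _).coeff_eq_zero (by simpa using hd.symm)
  have hQle : ∀ w, Q w → w ≤ n := fun w ⟨e, he, _⟩ => by
    simpa using he.fintype_card_le_finrank
  obtain ⟨w, ⟨e, he, hfe⟩, hmax⟩ : ∃ w, Q w ∧ ¬ Q (w + 1) := by
    by_contra! hcon
    have : ∀ w, Q w := fun w => Nat.rec hQ0 (fun k hk => hcon k hk) w
    exact absurd (hQle _ (this (n + 1))) (by omega)
  refine ⟨w, e, he, hfe, fun v hv => ?_⟩
  let p := restrictSpan (Fin.cons v e : Fin (w + 1) → Fin n → K) f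
  have hp0 : p ≠ 0 := fun h => hmax ⟨_, linearIndependent_finCons.2 ⟨he, hv⟩, h⟩
  have hcoeff : (finSuccEquiv K w p).coeff 0 = 0 := by
    rw [← hfe]
    exact coeff_zero_finSuccEquiv_restrictSpan_cons v e f
  obtain ⟨h1, h2⟩ := (hf.restrictSpan _).dehomogenize hp0 hcoeff
  refine ⟨_, h1, h2, fun y => ?_⟩
  have h3 := eval_eq_eval_mv_eval' y 1 p
  rw [eval_restrictSpan] at h3
  rw [Polynomial.eval_one_map] at h3
  rw [← h3, Fin.sum_univ_succ]
  simp

end MvPolynomial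

/-! ### Counting -/

open MvPolynomial in
/-- The Schwartz–Zippel bound over the whole of a finite field. -/
lemma MvPolynomial.card_zeros_le {K : Type*} [Field K] [Fintype K] [DecidableEq K] {k D : ℕ}
    {h : MvPolynomial (Fin (k + 1)) K} (h0 : h ≠ 0) (hD : h.totalDegree ≤ D) :
    (Finset.univ.filter fun y => eval y h = 0).card ≤ D * Fintype.card K ^ k := by
  have hS := schwartz_zippel_totalDegree h0 (Finset.univ : Finset K)
  rw [Fintype.piFinset_univ, Finset.card_univ] at hS
  have hq : (0 : ℚ≥0) < Fintype.card K := by exact_mod_cast Fintype.card_pos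
  rw [div_le_div_iff₀ (by positivity) hq, pow_succ, ← mul_assoc] at hS
  have h1 := le_of_mul_le_mul_right hS hq
  have h2 : (Finset.univ.filter fun y => eval y h = 0).card ≤
      h.totalDegree * Fintype.card K ^ k := by exact_mod_cast h1
  exact h2.trans (Nat.mul_le_mul_right _ hD)

open MvPolynomial in
/-- Counting zeros coset by coset: the span of `e`, of dimension `k + 1`, contributes all its
elements, each other coset at most `D * q ^ k` of them. -/
lemma MvPolynomial.card_zeros_le_of_cosets {K : Type*} [Field K] [Fintype K] [DecidableEq K]
    {n k D : ℕ} (f : MvPolynomial (Fin n) K) {e : Fin (k + 1) → Fin n → K}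
    (he : LinearIndependent K e)
    (hcos : ∀ v ∉ Submodule.span K (Set.range e), ∃ h : MvPolynomial (Fin (k + 1)) K, h ≠ 0 ∧
      h.totalDegree ≤ D ∧ ∀ y, eval y h = eval (v + ∑ j, y j • e j) f) :
    (Finset.univ.filter fun x => eval x f = 0).card ≤ Fintype.card K ^ (k + 1) +
      (Fintype.card K ^ (n - (k + 1)) - 1) * (D * Fintype.card K ^ k) := by
  classical
  set W := Submodule.span K (Set.range e) with hW
  let _ : Fintype ((Fin n → K) ⧸ W) := Fintype.ofFinite _
  have hquot : Fintype.card ((Fin n → K) ⧸ W) = Fintype.card K ^ (n - (k + 1)) := by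
    rw [Module.card_eq_pow_finrank (K := K)]
    congr 1
    have h1 := W.finrank_quotient_add_finrank
    rw [hW, finrank_span_eq_card he] at h1
    simp only [Fintype.card_fin, Module.finrank_fintype_fun_eq_card] at h1
    change Module.finrank K ((Fin n → K) ⧸ W) + (k + 1) = n at h1
    omega
  have hmem : ∀ x v : Fin n → K, (W.mkQ x = W.mkQ v) → ∃ y : Fin (k + 1) → K,
      v + ∑ j, y j • e j = x := fun x v hxv => by
    have h1 : x - v ∈ W := (Submodule.Quotient.eq W).1 hxv
    obtain ⟨y, hy⟩ := (Submodule.mem_span_range_iff_exists_fun K).1 h1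
    exact ⟨y, by rw [hy]; abel⟩
  rw [Finset.card_eq_sum_card_fiberwise (f := W.mkQ) (t := Finset.univ) (by simp),
    ← Finset.add_sum_erase _ _ (Finset.mem_univ 0)]
  refine Nat.add_le_add ?_ ?_
  · calc _ ≤ ((Finset.univ : Finset (Fin (k + 1) → K)).image fun y => 0 + ∑ j, y j • e j).card := by
          refine Finset.card_le_card fun x hx => ?_
          rw [Finset.mem_filter] at hx
          obtain ⟨y, hy⟩ := hmem x 0 (by rw [hx.2, map_zero])
          exact Finset.mem_image.2 ⟨y, Finset.mem_univ _, hy⟩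
      _ ≤ _ := Finset.card_image_le.trans (by simp)
  · rw [← hquot, ← Finset.card_univ, ← Finset.card_erase_of_mem (Finset.mem_univ 0)]
    refine Finset.sum_le_card_nsmul _ _ _ fun c hc => ?_
    obtain ⟨v, rfl⟩ := W.mkQ_surjective c
    have hv : v ∉ W := fun h => Finset.ne_of_mem_erase hc ((Submodule.Quotient.mk_eq_zero W).2 h)
    obtain ⟨h, h0, hD, hy⟩ := hcos v hv
    calc _ ≤ ((Finset.univ.filter fun y => eval y h = 0).image
            fun y => v + ∑ j, y j • e j).card := by
          refine Finset.card_le_card fun x hx => ?_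
          rw [Finset.mem_filter, Finset.mem_filter] at hx
          obtain ⟨y, rfl⟩ := hmem x v hx.2
          refine Finset.mem_image.2 ⟨y, ?_, rfl⟩
          simpa [hy] using hx.1.2
      _ ≤ _ := Finset.card_image_le
      _ ≤ _ := card_zeros_le h0 hD

/-- A hypersurface with `N` points over the field with `q` elements has at least `N * (q - 1)`
nonzero affine zeros; the origin is one more. -/
lemma ProjHypersurface.numPoints_mul_add_one_le {K : Type*} [Field K] [Fintype K] [DecidableEq K]
    {m d : ℕ} (hd : d ≠ 0) (X : ProjHypersurface K m d) :
    X.numPoints * (Fintype.card K - 1) + 1 ≤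
      (Finset.univ.filter fun x => MvPolynomial.eval x X.equation = 0).card := by
  have hzero : ∀ (u : Kˣ) (P : ℙ K (Fin (m + 1) → K)), P ∈ X.points →
      MvPolynomial.eval ((u : K) • P.rep) X.equation = 0 := fun u P hP => by
    have hne : (u : K) • P.rep ≠ 0 := smul_ne_zero u.ne_zero P.rep_nonzero
    rw [← X.mk_mem_points_iff _ hne]
    convert hP
    conv_rhs => rw [← P.mk_rep]
    exact (Projectivization.mk_eq_mk_iff' ..).2 ⟨u, rfl⟩
  have hzero0 : MvPolynomial.eval 0 X.equation = 0 := by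
    rw [MvPolynomial.eval_zero, MvPolynomial.constantCoeff_eq]
    exact X.isHomogeneous.coeff_eq_zero (by simpa using hd.symm)
  let g : Option (X.points × Kˣ) → {x : Fin (m + 1) → K // MvPolynomial.eval x X.equation = 0} :=
    fun o => o.elim ⟨0, hzero0⟩ fun a => ⟨(a.2 : K) • a.1.1.rep, hzero a.2 a.1.1 a.1.2⟩
  have hg : Function.Injective g := by
    rintro (_ | ⟨⟨P, hP⟩, u⟩) (_ | ⟨⟨P', hP'⟩, u'⟩) h
    · rfl
    · exact absurd (congrArg Subtype.val h).symm (smul_ne_zero u'.ne_zero P'.rep_nonzero)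
    · exact absurd (congrArg Subtype.val h) (smul_ne_zero u.ne_zero P.rep_nonzero)
    · have h1 : (u : K) • P.rep = (u' : K) • P'.rep := congrArg Subtype.val h
      have h2 : P = P' := by
        rw [← P.mk_rep, ← P'.mk_rep, Projectivization.mk_eq_mk_iff']
        exact ⟨(u : K)⁻¹ * u', by rw [mul_smul, ← h1, inv_smul_smul₀ u.ne_zero]⟩
      subst h2
      have h3 : u = u' := Units.ext (smul_left_injective K P.rep_nonzero h1)
      rw [h3]
  have h1 := Nat.card_le_card_of_injective g hg
  rw [Finite.card_option, Nat.card_prod, Nat.card_eq_fintype_card (α := Kˣ), Fintype.card_units,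
    Nat.card_coe_set_eq, Nat.card_eq_fintype_card, Fintype.card_subtype] at h1
  exact h1

/-! ### Arithmetic -/

lemma theta_mul_sub_one (q r : ℕ) : (theta q r : ℤ) * (q - 1) = q ^ (r + 1) - 1 := by
  rw [theta, Nat.cast_sum, ← geom_sum_mul]
  simp

/-- The coset bound for a maximal subspace of projective dimension `k` is at most the corresponding
bound for `k' ≥ k`: for `d - 1 ≤ q` it increases with `k`, and for larger `d` the bound for `k'`
is at least the number of all points of the projective space. Here `Z` stands for the number of
affine zeros, the origin included, and `N` for the number of projective ones. -/
lemma le_theta_of_card_le {q m k k' D N Z : ℕ} (hq : 2 ≤ q) (hk : k ≤ k') (hk' : k' + 1 ≤ m)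
    (hN : N * (q - 1) + 1 ≤ Z) (hall : Z ≤ q ^ (m + 1))
    (hZ : Z ≤ q ^ (k + 1) + (q ^ (m - k) - 1) * (D * q ^ k)) :
    N ≤ theta q k' + theta q (m - 1 - k') * q ^ k' * D := by
  have hq0 : 0 < q := by omega
  have e1 : ((q ^ (m - k) - 1 : ℕ) : ℤ) = (q : ℤ) ^ (m - k) - 1 := by
    rw [Nat.cast_sub (Nat.one_le_pow _ _ hq0)]; simp
  have e2 : ((q - 1 : ℕ) : ℤ) = (q : ℤ) - 1 := by rw [Nat.cast_sub (by omega)]; simp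
  zify at hN hall hZ
  rw [e2] at hN
  rw [e1] at hZ
  have p1 : (q : ℤ) ^ (m - k) * q ^ k = q ^ m := by rw [← pow_add]; congr 1; omega
  have p2 : (q : ℤ) ^ (m - 1 - k' + 1) * q ^ k' = q ^ m := by rw [← pow_add]; congr 1; omega
  have hR : ((theta q k' + theta q (m - 1 - k') * q ^ k' * D : ℕ) : ℤ) * (q - 1) + 1 =
      D * q ^ m + (q - D) * q ^ k' := by
    have t1 := theta_mul_sub_one q k'
    have t2 := theta_mul_sub_one q (m - 1 - k')
    push_cast
    linear_combination t1 + (q : ℤ) ^ k' * D * t2 + (D : ℤ) * p2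
  have hL : (N : ℤ) * (q - 1) + 1 ≤ D * q ^ m + (q - D) * q ^ k' := by
    rcases le_total D q with h | h
    · have h' : (0 : ℤ) ≤ q - D := by have : (D : ℤ) ≤ q := by exact_mod_cast h
                                      linarith
      have hpow : (q : ℤ) ^ k ≤ q ^ k' := pow_le_pow_right₀ (by exact_mod_cast hq0) hk
      have := mul_le_mul_of_nonneg_left hpow h'
      linear_combination hN + hZ + this + (D : ℤ) * p1
    · have h' : (0 : ℤ) ≤ D - q := by have : (q : ℤ) ≤ D := by exact_mod_cast h
                                      linarith
      have hpow : (q : ℤ) ^ k' ≤ q ^ m := pow_le_pow_right₀ (by exact_mod_cast hq0) (by omega)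
      have := mul_le_mul_of_nonneg_left hpow h'
      linear_combination hN + hall + this
  have hpos : (0 : ℤ) < q - 1 := by have : (2 : ℤ) ≤ q := by exact_mod_cast hq
                                    linarith
  have h : (N : ℤ) ≤ ((theta q k' + theta q (m - 1 - k') * q ^ k' * D : ℕ) : ℤ) :=
    le_of_mul_le_mul_right (by linarith) hpos
  exact_mod_cast h

/-! ### The bound for nonsingular hypersurfaces -/

/-- A linear subspace of projective dimension `w - 1` on a nonsingular hypersurface in `ℙ^m`
satisfies `w - 1 ≤ (m - 1) / 2`. -/
lemma ProjHypersurface.IsNonsingular.two_mul_le {K : Type*} [Field K] {m d w : ℕ} (hd : 2 ≤ d)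
    {X : ProjHypersurface K m d} (hX : X.IsNonsingular) {e : Fin w → Fin (m + 1) → K}
    (he : LinearIndependent K e) (hXe : MvPolynomial.restrictSpan e X.equation = 0) :
    2 * w ≤ m + 1 := by
  by_contra! hw
  let L := AlgebraicClosure K
  have hXe' : MvPolynomial.restrictSpan (fun j => algebraMap K L ∘ e j)
      (X.baseChange L).equation = 0 := by
    rw [baseChange, ← MvPolynomial.map_restrictSpan, hXe, map_zero]
  obtain ⟨x, hx0, hx, hx'⟩ := MvPolynomial.exists_singular_of_restrictSpan_eq_zero hd
    (X.baseChange L).isHomogeneous (linearIndependent_algebraMap_comp_iff.2 he) hXe'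
    (by simpa using hw)
  exact hX _ (((X.baseChange L).isSingularAt_mk_iff x hx0).2 ⟨hx, hx'⟩)

/-- Both parities at once: if `k'` bounds the projective dimension of the linear subspaces that can
lie on a nonsingular hypersurface, the number of points is at most the corresponding bound. -/
lemma ProjHypersurface.IsNonsingular.numPoints_le {K : Type*} [Field K] [Finite K] {q m d k' : ℕ}
    (hq : Nat.card K = q) (hd : 2 ≤ d) {X : ProjHypersurface K m d} (hX : X.IsNonsingular)
    (hk' : k' + 1 ≤ m) (hm : m ≤ 2 * k' + 2) :
    X.numPoints ≤ theta q k' + theta q (m - 1 - k') * q ^ k' * (d - 1) := by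
  classical
  let _ : Fintype K := Fintype.ofFinite K
  rw [Nat.card_eq_fintype_card] at hq
  have hq2 : 2 ≤ q := hq ▸ Fintype.one_lt_card
  have hN := X.numPoints_mul_add_one_le (by omega)
  rw [hq] at hN
  obtain ⟨w, e, he, hXe, hcos⟩ :=
    MvPolynomial.exists_maximal_restrictSpan_eq_zero (by omega) X.isHomogeneous
  have hw := hX.two_mul_le hd he hXe
  rcases w with _ | k
  · -- the zero subspace is maximal only if there are no nonzero zeros
    have hzeros : (Finset.univ.filter fun x => MvPolynomial.eval x X.equation = 0) ⊆ {0} := by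
      intro x hx
      by_contra hx0
      obtain ⟨h, h0, -, hy⟩ := hcos x (by simpa using hx0)
      have h1 := hy 0
      rw [MvPolynomial.eq_C_of_isEmpty h] at h0 h1
      rw [Finset.univ_eq_empty, Finset.sum_empty, add_zero, (Finset.mem_filter.1 hx).2,
        MvPolynomial.eval_C] at h1
      exact h0 (by rw [h1, map_zero])
    have h1 := hN.trans ((Finset.card_le_card hzeros).trans_eq (Finset.card_singleton _))
    have h2 : X.numPoints = 0 :=
      (Nat.mul_eq_zero.1 (by omega : X.numPoints * (q - 1) = 0)).resolve_right (by omega)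
    omega
  · refine le_theta_of_card_le (k := k) hq2 (by omega) hk' hN
      ((Finset.card_le_univ _).trans_eq (by simp [hq])) ?_
    have h := MvPolynomial.card_zeros_le_of_cosets X.equation he hcos
    rwa [hq, Nat.add_sub_add_right] at h

theorem mainTheorem4 {K : Type*} [Field K] [Finite K] (q m d : ℕ) (hq : Nat.card K = q)
    (hm : 1 ≤ m) (hd : 2 ≤ d) (X : ProjHypersurface K m d) (hX : X.IsNonsingular) :
    (Odd m →
      X.numPoints ≤ theta q ((m - 1) / 2) * ((d - 1) * q ^ ((m - 1) / 2) + 1)) ∧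
    (Even m →
      X.numPoints ≤ theta q (m / 2) * q ^ (m / 2 - 1) * (d - 1) + theta q (m / 2 - 1)) := by
  constructor
  · rintro ⟨k, rfl⟩
    have h := hX.numPoints_le (k' := k) hq hd (by omega) (by omega)
    rw [show 2 * k + 1 - 1 - k = k by omega] at h
    rw [show (2 * k + 1 - 1) / 2 = k by omega]
    exact h.trans_eq (by ring)
  · rintro ⟨k, rfl⟩
    have h := hX.numPoints_le (k' := k - 1) hq hd (by omega) (by omega)
    rw [show k + k - 1 - (k - 1) = k by omega] at h
    rw [show (k + k) / 2 = k by omega]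
    exact h.trans_eq (add_comm _ _)
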